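/- Let $B_3=\langle \sigma_1,\sigma_2 \mid \sigma_1\sigma_2\sigma_1=\sigma_2\sigma_1\sigma_2\rangle$ be the braid group on three strings, let $A_{1,2}=\sigma_1^2$, $A_{1,3}=\sigma_2\sigma_1^2\sigma_2^{-1}$, $A_{2,3}=\sigma_2^2$, let $P_3=\langle A_{1,2},A_{1,3},A_{2,3}\rangle\le B_3$ be the pure braid group, with center $Z(P_3)$, and put $z=A_{1,2}A_{1,3}A_{2,3}$. Let $\operatorname{Aut}_c(P_3)$ be the group of automorphisms of $P_3$ that induce the identity on $P_3/Z(P_3)$. Then there are automorphisms $\rho,\sigma,\nu,\psi,\phi_{1,3},\phi_{2,3}$ of $P_3$ with the following values on the triple $(A_{1,2},A_{1,3},A_{2,3})$: $$\begin{aligned} \rho&:\ (A_{2,3}A_{1,2}A_{2,3}^{-1},\ A_{2,3},\ A_{1,3}), & \psi&:\ (A_{1,2}z^{-2},\ A_{1,3},\ A_{2,3}),\\ \sigma&:\ (A_{1,2}A_{1,3}^{2},\ A_{1,3}^{-1},\ A_{2,3}), & \phi_{1,3}&:\ (A_{1,2}z,\ A_{1,3}z^{-1},\ A_{2,3}),\\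 \nu&:\ (A_{2,3}^{-1}A_{1,2},\ A_{1,3}A_{2,3},\ A_{2,3}), & \phi_{2,3}&:\ (A_{1,2}z,\ A_{1,3},\ A_{2,3}z^{-1}), \end{aligned}$$ and the group $\operatorname{Aut}(P_3)$ is generated by $\{\rho,\sigma,\nu,\psi,\phi_{1,3},\phi_{2,3}\}$. Moreover, $\rho,\sigma,\nu$ fix $Z(P_3)$ pointwise; $P_3/Z(P_3)$ is a free group of rank $2$ on the classes of $A_{1,3}$ and $A_{2,3}$, and the automorphisms induced by $\rho,\sigma,\nu$ (the Nielsen automorphisms) generate $\operatorname{Aut}(P_3/Z(P_3))$; and $\psi,\phi_{1,3},\phi_{2,3}$ generate $\operatorname{Aut}_c(P_3)$. In particular, $\operatorname{Aut}(P_3)$ is generated by $\operatorname{Aut}_c(P_3)$ together with $\rho,\sigma,\nu$. -/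

import Mathlib

/-- The braid relator `(s₁ s₂ s₁)(s₂ s₁ s₂)⁻¹`; the index `0` stands for `s₁` and `1` for `s₂`. -/
def braidRelator : FreeGroup (Fin 2) :=
  (FreeGroup.of 0 * FreeGroup.of 1 * FreeGroup.of 0) *
    (FreeGroup.of 1 * FreeGroup.of 0 * FreeGroup.of 1)⁻¹

/-- The Artin braid group on three strings, `B₃ = ⟨s₁, s₂ | s₁ s₂ s₁ = s₂ s₁ s₂⟩`. -/
abbrev B3 : Type := PresentedGroup ({braidRelator} : Set (FreeGroup (Fin 2)))

namespace B3

/-- The first standard generator of `B₃`. -/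
def s1 : B3 := PresentedGroup.of 0

/-- The second standard generator of `B₃`. -/
def s2 : B3 := PresentedGroup.of 1

/-- `A_{1,2} = s₁²`. -/
def a12 : B3 := s1 ^ 2

/-- `A_{1,3} = s₂ s₁² s₂⁻¹`. -/
def a13 : B3 := s2 * s1 ^ 2 * s2⁻¹

/-- `A_{2,3} = s₂²`. -/
def a23 : B3 := s2 ^ 2

end B3

/-- The pure braid group on three strings: the subgroup of `B₃` generated by
`A_{1,2}`, `A_{1,3}` and `A_{2,3}`. -/
def P3 : Subgroup B3 := Subgroup.closure {B3.a12, B3.a13, B3.a23}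

namespace P3

/-- `A_{1,2}` as an element of `P₃`. -/
def A12 : P3 := ⟨B3.a12, Subgroup.subset_closure (by simp)⟩

/-- `A_{1,3}` as an element of `P₃`. -/
def A13 : P3 := ⟨B3.a13, Subgroup.subset_closure (by simp)⟩

/-- `A_{2,3}` as an element of `P₃`. -/
def A23 : P3 := ⟨B3.a23, Subgroup.subset_closure (by simp)⟩

/-- The full twist `z = A_{1,2} A_{1,3} A_{2,3}`. -/
def z : P3 := A12 * A13 * A23

end P3

/-- The homomorphism `Aut(G) → Aut(G / Z(G))`: every automorphism preserves the center. -/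
def autCentralQuotient (G : Type*) [Group G] : MulAut G →* MulAut (G ⧸ Subgroup.center G) where
  toFun f := QuotientGroup.congr (Subgroup.center G) (Subgroup.center G) f
    (Subgroup.characteristic_iff_map_eq.mp inferInstance f)
  map_one' := by
    ext x
    induction x using QuotientGroup.induction_on with
    | H g => rfl
  map_mul' f g := by
    ext x
    induction x using QuotientGroup.induction_on with
    | H g => rfl

/-- The group `Aut_c(G)` of central automorphisms of `G`, those inducing the identity
on `G / Z(G)`. -/
def centralAut (G : Type*) [Group G] : Subgroup (MulAut G) := (autCentralQuotient G).ker

/-! The full twist `z` is central, and $P_3$ is the direct product of the free group $F$ on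
$A_{1,3},A_{2,3}$ and the infinite cyclic group $\langle z\rangle$ (`prodEquiv`). Injectivity rests
on two homomorphisms: under `B3.action` the elements of $F$ act by conjugation, which is faithful,
while $z$ acts trivially; and `B3.degree` takes the value $6$ on $z$. Hence $Z(P_3)=\langle
z\rangle$ and $P_3/Z(P_3)\cong F$. Every automorphism of $F$ extends by the identity on $z$, so
$\operatorname{Aut}(P_3)\to\operatorname{Aut}(F)$ is onto with kernel $\operatorname{Aut}_c(P_3)$. A
central automorphism is a sign on $z$ together with a homomorphism $F\to\langle z\rangle$, which
gives $\psi,\phi_{1,3},\phi_{2,3}$ (`closure_eq_centralAut`). What remains is Nielsen's theorem in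
rank two (`mem_nielsenSubgroup`). If Nielsen moves and conjugations cannot shorten the images of the
generators, then so little cancels between these images that the automorphism never decreases word
length; its inverse then sends generators to letters. -/

/-! ### Common prefixes of lists -/

/-- The length of the longest common prefix of two lists. -/
def List.commonPrefixLength {β : Type*} [DecidableEq β] : List β → List β → ℕ
  | a :: l, b :: m => if a = b then commonPrefixLength l m + 1 else 0
  | _, _ => 0

namespace List

variable {β : Type*} [DecidableEq β]

theorem exists_commonPrefix (l m : List β) :
    ∃ p l' m', l = p ++ l' ∧ m = p ++ m' ∧ p.length = commonPrefixLength l m ∧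
      ∀ a ∈ l'.head?, ∀ b ∈ m'.head?, a ≠ b := by
  induction l generalizing m with
  | nil => exact ⟨[], [], m, by simp [commonPrefixLength]⟩
  | cons a l ih =>
    cases m with
    | nil => exact ⟨[], a :: l, [], by simp [commonPrefixLength]⟩
    | cons b m =>
      by_cases h : a = b
      · subst h
        obtain ⟨p, l', m', h1, h2, h3, h4⟩ := ih m
        exact ⟨a :: p, l', m', by simp [← h1], by simp [← h2], by simp [commonPrefixLength, h3], h4⟩
      · exact ⟨[], a :: l, b :: m, by simp [commonPrefixLength, h]⟩

theorem le_commonPrefixLength_iff {l m : List β} {k : ℕ} :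
    k ≤ commonPrefixLength l m ↔ k ≤ l.length ∧ k ≤ m.length ∧ l.take k = m.take k := by
  induction l generalizing m k with
  | nil => cases k <;> simp [commonPrefixLength]
  | cons a l ih =>
    cases m with
    | nil => cases k <;> simp [commonPrefixLength]
    | cons b m =>
      cases k with
      | zero => simp
      | succ k =>
        by_cases h : a = b
        · simp [commonPrefixLength, h, ih]
        · simp [commonPrefixLength, h]

end List

/-! ### Cancellation in free groups -/

namespace FreeGroup

variable {α : Type*} [DecidableEq α]

theorem IsReduced.norm_mk {L : List (α × Bool)} (h : IsReduced L) : norm (mk L) = L.length := by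
  rw [norm, toWord_mk, h.reduce_eq]

/-- The length of the longest common prefix of the reduced words of two elements. -/
def overlap (g h : FreeGroup α) : ℕ := g.toWord.commonPrefixLength h.toWord

theorem overlap_comm (g h : FreeGroup α) : overlap g h = overlap h g := by
  refine eq_of_forall_le_iff fun k => ?_
  simp only [overlap, List.le_commonPrefixLength_iff]
  tauto

/-- Agreement of the first `n` letters is transitive, so `overlap` obeys an ultrametric inequality.
-/
theorem min_overlap_le (g h k : FreeGroup α) :
    min (overlap g h) (overlap h k) ≤ overlap g k := by
  have h1 := List.le_commonPrefixLength_iff.1 (min_le_left (overlap g h) (overlap h k))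
  have h2 := List.le_commonPrefixLength_iff.1 (min_le_right (overlap g h) (overlap h k))
  exact List.le_commonPrefixLength_iff.2 ⟨h1.1, h2.2.1, h1.2.2.trans h2.2.2⟩

/-- The common prefix is exactly what cancels, once from each word: past it the first letters
differ, so the remainders join to a reduced word. -/
theorem norm_inv_mul_add (g h : FreeGroup α) :
    norm (g⁻¹ * h) + 2 * overlap g h = norm g + norm h := by
  obtain ⟨p, l, m, h1, h2, h3, h4⟩ := List.exists_commonPrefix g.toWord h.toWord
  have hg : IsReduced (p ++ l) := h1 ▸ isReduced_toWord
  have hh : IsReduced (p ++ m) := h2 ▸ isReduced_toWord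
  have hl : IsReduced l := hg.infix ⟨p, [], by simp⟩
  have hm : IsReduced m := hh.infix ⟨p, [], by simp⟩
  have hl' : IsReduced (invRev l) := by
    rw [isReduced_iff_reduce_eq, reduce_invRev, hl.reduce_eq]
  have hr : IsReduced (invRev l ++ m) := by
    refine List.isChain_append.2 ⟨hl', hm, fun a ha b hb hab => ?_⟩
    cases l with
    | nil => simp [invRev] at ha
    | cons c l =>
      have : a = (c.1, !c.2) := by simpa [invRev, eq_comm] using ha
      have hc := h4 c (by simp) b hb
      subst this
      obtain ⟨c1, c2⟩ := c
      obtain ⟨b1, b2⟩ := b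
      simp only at hab
      subst hab
      simp only [ne_eq, Prod.mk.injEq, true_and] at hc
      cases c2 <;> cases b2 <;> simp_all
  have e : g⁻¹ * h = mk (invRev l ++ m) := by
    rw [← mk_toWord (x := g), ← mk_toWord (x := h), h1, h2, ← mul_mk, ← mul_mk, ← mul_mk, ← inv_mk]
    group
  rw [e, hr.norm_mk, norm, norm, overlap, ← h3, h1, h2]
  simp
  omega

theorem norm_mul_add (g h : FreeGroup α) :
    norm (g * h) + 2 * overlap g⁻¹ h = norm g + norm h := by
  simpa using norm_inv_mul_add g⁻¹ h

/-- With $g=crc^{-1}$ and $r\neq1$ cyclically reduced, $g^2=crrc^{-1}$ is still reduced. -/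
theorem norm_lt_norm_mul_self {g : FreeGroup α} (hg : g ≠ 1) : norm g < norm (g * g) := by
  have h1 := reduceCyclically.conj_conjugator_reduceCyclically g.toWord
  have h2 := reduceCyclically.reduce_flatten_replicate (isReduced_toWord (x := g)) 2
  rw [← toWord_pow, pow_two] at h2
  have h3 : (reduceCyclically g.toWord).length ≠ 0 := by
    intro h
    rw [List.length_eq_zero_iff] at h
    rw [h] at h1
    apply hg
    rw [← mk_toWord (x := g), ← h1, List.append_nil, ← mul_mk, ← inv_mk, mul_inv_cancel]
  rw [norm, norm, h2]
  replace h1 := congrArg List.length h1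
  simp at h1 ⊢
  omega

theorem two_mul_overlap_inv_self_lt {g : FreeGroup α} (hg : g ≠ 1) :
    2 * overlap g⁻¹ g < norm g := by
  have := norm_mul_add g g
  have := norm_lt_norm_mul_self hg
  omega

section Reduced

variable {γ : Type*} {f : γ × Bool → FreeGroup α}

/-- By `h2` the cancellations at the two ends of a factor never meet, so each middle factor keeps a
letter. The second conclusion drives the induction: the first factor loses only what it cancels
against the second. -/
theorem length_add_norm_le_norm_prod_add_overlap
    (h1 : ∀ s t : γ × Bool, (s.1 = t.1 → s.2 = t.2) → overlap (f s)⁻¹ (f t) < norm (f t))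
    (h2 : ∀ s t r : γ × Bool, (s.1 = t.1 → s.2 = t.2) → (t.1 = r.1 → t.2 = r.2) →
      overlap (f s)⁻¹ (f t) + overlap (f t)⁻¹ (f r) < norm (f t))
    (s t : γ × Bool) (L : List (γ × Bool)) (hL : IsReduced (s :: t :: L)) :
    L.length + 1 + norm (f s) ≤
        norm ((s :: t :: L).map f).prod + overlap (f s)⁻¹ (f t) ∧
      overlap (f s) ((s :: t :: L).map f).prod + overlap (f s)⁻¹ (f t) = norm (f s) := by
  induction L generalizing s t with
  | nil =>
    rw [IsReduced, List.isChain_pair] at hL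
    have := h1 s t hL
    have e1 := norm_mul_add (f s) (f t)
    have e2 := norm_inv_mul_add (f s) (f s * f t)
    rw [inv_mul_cancel_left] at e2
    simp only [List.map_cons, List.map_nil, List.prod_cons, List.prod_nil, mul_one,
      List.length_nil]
    omega
  | cons r L ih =>
    rw [IsReduced, List.isChain_cons_cons] at hL
    have hr := List.isChain_cons_cons.1 hL.2
    obtain ⟨i1, i2⟩ := ih t r hL.2
    have := h2 s t r hL.1 hr.1
    rw [List.map_cons, List.prod_cons]
    generalize ((t :: r :: L).map f).prod = g at *
    have e1 := norm_mul_add (f s) g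
    have e2 := norm_inv_mul_add (f s) (f s * g)
    rw [inv_mul_cancel_left] at e2
    -- The tail product `g` agrees with `f t` beyond the part cancelled by `f s`, so both
    -- inequalities together give `overlap (f s)⁻¹ g = overlap (f s)⁻¹ (f t)`.
    have u1 := min_overlap_le (f s)⁻¹ (f t) g
    have u2 := min_overlap_le (f s)⁻¹ g (f t)
    rw [overlap_comm g] at u2
    simp only [List.length_cons]
    omega

theorem length_le_norm_prod
    (h0 : ∀ s, f s ≠ 1)
    (h1 : ∀ s t : γ × Bool, (s.1 = t.1 → s.2 = t.2) →
      overlap (f s)⁻¹ (f t) < norm (f s) ∧ overlap (f s)⁻¹ (f t) < norm (f t))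
    (h2 : ∀ s t r : γ × Bool, (s.1 = t.1 → s.2 = t.2) → (t.1 = r.1 → t.2 = r.2) →
      overlap (f s)⁻¹ (f t) + overlap (f t)⁻¹ (f r) < norm (f t))
    (L : List (γ × Bool)) (hL : IsReduced L) : L.length ≤ norm (L.map f).prod := by
  match L, hL with
  | [], _ => simp
  | [s], _ => simpa [Nat.one_le_iff_ne_zero] using h0 s
  | s :: t :: L, hL =>
    have := (length_add_norm_le_norm_prod_add_overlap (fun s t h => (h1 s t h).2) h2 s t L hL).1
    have := h1 s t (List.isChain_cons_cons.1 hL).1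
    simp only [List.length_cons]
    omega

end Reduced

/-- If `b` cancels half-half against `a` on both sides, a conjugation shortens `(a * b, b)`. -/
theorem exists_conj_norm_lt {a b : FreeGroup α} (hb : b ≠ 1)
    (h1 : 2 * overlap a⁻¹ b = norm b) (h2 : 2 * overlap b⁻¹ a = norm b) (hab : norm b ≤ norm a) :
    ∃ q, norm (q⁻¹ * (a * b) * q) + norm (q⁻¹ * b * q) < norm a + norm b := by
  obtain ⟨P, T, T', p1, p2, p3, -⟩ := List.exists_commonPrefix a⁻¹.toWord b.toWord
  obtain ⟨Q, R', R, q1, q2, q3, -⟩ := List.exists_commonPrefix b⁻¹.toWord a.toWord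
  change _ = overlap _ _ at p3 q3
  have hn : norm b ≠ 0 := by simpa using hb
  have lb : b.toWord.length = norm b := rfl
  have la : a.toWord.length = norm a := rfl
  have hT' : T' = invRev Q := by
    rw [toWord_inv, p2, invRev_append] at q1
    have := (List.append_inj q1 (by
      have := congrArg List.length p2
      simp at this ⊢
      omega)).1
    rw [← this, invRev_invRev]
  obtain ⟨M, hM⟩ : ∃ M, a.toWord = Q ++ M ++ invRev P := by
    rw [toWord_inv] at p1
    have e : a.toWord = invRev T ++ invRev P := by
      rw [← invRev_append, ← p1, invRev_invRev]
    have hl := congrArg List.length q2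
    have hl' := congrArg List.length e
    simp at hl hl'
    rw [q2] at e
    obtain ⟨M, hM, hM'⟩ | ⟨M, hM, hM'⟩ := List.append_eq_append_iff.1 e
    · exact ⟨M, by rw [q2, hM', List.append_assoc]⟩
    · have hM1 := congrArg List.length hM
      simp at hM1
      have : M = [] := List.length_eq_zero_iff.1 (by omega)
      subst this
      exact ⟨[], by rw [q2]; simpa using hM'.symm⟩
  have ha : a = mk Q * mk M * (mk P)⁻¹ := by
    rw [← mk_toWord (x := a), hM, ← mul_mk, ← mul_mk, ← inv_mk]
  have hb' : b = mk P * (mk Q)⁻¹ := by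
    rw [← mk_toWord (x := b), p2, hT', ← mul_mk, ← inv_mk]
  -- Now $a=QMP^{-1}$ and $b=PQ^{-1}$ with $|P|=|Q|$. Conjugation turns $ab$ into $M$ and $b$ into
  -- $Q^{-1}P$, of total length at most $|a|$.
  refine ⟨mk Q, ?_⟩
  have e1 : (mk Q)⁻¹ * (a * b) * mk Q = mk M := by rw [ha, hb']; group
  have e2 : (mk Q)⁻¹ * b * mk Q = (mk Q)⁻¹ * mk P := by rw [hb']; group
  rw [e1, e2]
  have n1 : norm (mk M) ≤ M.length := norm_mk_le
  have n2 := norm_mul_le (mk Q)⁻¹ (mk P)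
  have n3 : norm (mk Q) ≤ Q.length := norm_mk_le
  have n4 : norm (mk P) ≤ P.length := norm_mk_le
  rw [norm_inv_eq] at n2
  have := congrArg List.length hM
  simp at this
  omega

/-- Conjugation is faithful on a free group of rank at least two. -/
theorem conj_injective [Nontrivial α] :
    Function.Injective (MulAut.conj : FreeGroup α →* MulAut (FreeGroup α)) := by
  refine (injective_iff_map_eq_one _).2 fun g hg => ?_
  by_contra hg1
  obtain ⟨⟨i, b⟩, L, hL⟩ := List.exists_cons_of_ne_nil (mt toWord_eq_nil_iff.1 hg1)
  obtain ⟨j, hj⟩ := exists_ne i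
  have hc : g * of j = of j * g := by
    have := DFunLike.congr_fun hg (of j)
    rwa [MulAut.conj_apply, MulAut.one_apply, mul_inv_eq_iff_eq_mul] at this
  -- No cancellation occurs on the left, so both sides of `hc` are reduced words of full length,
  -- with first letters of index `j` and `i`.
  have h1 : (of j * g).toWord = (j, true) :: (i, b) :: L := by
    rw [toWord_mul, toWord_of, hL, List.singleton_append]
    refine IsReduced.reduce_eq (List.isChain_cons_cons.2 ⟨fun h => absurd h hj, ?_⟩)
    rw [← hL]
    exact isReduced_toWord
  have h2 := toWord_mul_sublist g (of j)
  rw [hc, h1, hL, toWord_of] at h2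
  have := h2.eq_of_length (by simp)
  simp at this
  exact hj this.1.1

end FreeGroup

/-! ### Nielsen's theorem in rank two -/

namespace FreeGroup

@[simp]
theorem mk_singleton_true {α : Type*} (a : α) : mk [(a, true)] = of a := rfl

@[simp]
theorem mk_singleton_false {α : Type*} (a : α) : mk [(a, false)] = (of a)⁻¹ := rfl

theorem map_mk_eq_prod {α G : Type*} [Group G] (φ : FreeGroup α →* G) (L : List (α × Bool)) :
    φ (mk L) = (L.map fun s => φ (mk [s])).prod := by
  induction L with
  | nil => simp [← one_eq_mk]
  | cons s L ih => rw [List.map_cons, List.prod_cons, ← ih, ← _root_.map_mul, mul_mk, List.singleton_append]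

theorem exists_mk_singleton_of_norm_le_one {α : Type*} [DecidableEq α] {g : FreeGroup α}
    (hg : g ≠ 1) (h : norm g ≤ 1) : ∃ s, g = mk [s] := by
  have h1 : g.toWord.length = 1 := le_antisymm h (Nat.one_le_iff_ne_zero.2 (by simpa using hg))
  obtain ⟨s, hs⟩ := List.length_eq_one_iff.1 h1
  exact ⟨s, by rw [← hs, mk_toWord]⟩

theorem mulAut_ext {φ ψ : MulAut (FreeGroup (Fin 2))} (h0 : φ (of 0) = ψ (of 0))
    (h1 : φ (of 1) = ψ (of 1)) : φ = ψ := by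
  have : φ.toMonoidHom = ψ.toMonoidHom := by
    ext i
    fin_cases i
    · exact h0
    · exact h1
  exact MulEquiv.ext fun g => DFunLike.congr_fun this g

/-- The automorphism of the free group of rank two with given values on the generators, whose
inverse has given values on the generators. -/
def mkAut (a b c d : FreeGroup (Fin 2)) (h0 : lift ![c, d] a = of 0) (h1 : lift ![c, d] b = of 1)
    (h2 : lift ![a, b] c = of 0) (h3 : lift ![a, b] d = of 1) : MulAut (FreeGroup (Fin 2)) :=
  MonoidHom.toMulEquiv (lift ![a, b]) (lift ![c, d])
    (by ext i; fin_cases i <;> simpa) (by ext i; fin_cases i <;> simpa)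

section
variable {a b c d : FreeGroup (Fin 2)} {h0 : lift ![c, d] a = of 0} {h1 : lift ![c, d] b = of 1}
    {h2 : lift ![a, b] c = of 0} {h3 : lift ![a, b] d = of 1}

@[simp]
theorem mkAut_zero : mkAut a b c d h0 h1 h2 h3 (of 0) = a := lift_apply_of

@[simp]
theorem mkAut_one : mkAut a b c d h0 h1 h2 h3 (of 1) = b := lift_apply_of

end

/-- The Nielsen automorphism exchanging the two generators. -/
def nielsenSwap : MulAut (FreeGroup (Fin 2)) :=
  mkAut (of 1) (of 0) (of 1) (of 0) (by simp) (by simp) (by simp) (by simp)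

/-- The Nielsen automorphism inverting the first generator. -/
def nielsenInv : MulAut (FreeGroup (Fin 2)) :=
  mkAut (of 0)⁻¹ (of 1) (of 0)⁻¹ (of 1) (by simp) (by simp) (by simp) (by simp)

/-- The Nielsen automorphism multiplying the first generator by the second. -/
def nielsenMul : MulAut (FreeGroup (Fin 2)) :=
  mkAut (of 0 * of 1) (of 1) (of 0 * (of 1)⁻¹) (of 1) (by simp) (by simp) (by simp) (by simp)

@[simp] theorem nielsenSwap_zero : nielsenSwap (of 0) = of 1 := mkAut_zero
@[simp] theorem nielsenSwap_one : nielsenSwap (of 1) = of 0 := mkAut_one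
@[simp] theorem nielsenInv_zero : nielsenInv (of 0) = (of 0)⁻¹ := mkAut_zero
@[simp] theorem nielsenInv_one : nielsenInv (of 1) = of 1 := mkAut_one
@[simp] theorem nielsenMul_zero : nielsenMul (of 0) = of 0 * of 1 := mkAut_zero
@[simp] theorem nielsenMul_one : nielsenMul (of 1) = of 1 := mkAut_one

/-- The subgroup generated by the Nielsen automorphisms. -/
def nielsenSubgroup : Subgroup (MulAut (FreeGroup (Fin 2))) :=
  Subgroup.closure {nielsenSwap, nielsenInv, nielsenMul}

theorem nielsenSwap_mem : nielsenSwap ∈ nielsenSubgroup := Subgroup.subset_closure (by simp)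
theorem nielsenInv_mem : nielsenInv ∈ nielsenSubgroup := Subgroup.subset_closure (by simp)
theorem nielsenMul_mem : nielsenMul ∈ nielsenSubgroup := Subgroup.subset_closure (by simp)

/-- Composing $x\mapsto xy$ with $x\mapsto y^{-1}x$ gives conjugation by $y^{-1}$; swapping the
generators handles $x$. -/
theorem conj_mem_nielsenSubgroup (g : FreeGroup (Fin 2)) : MulAut.conj g ∈ nielsenSubgroup := by
  have h1 : MulAut.conj (of 1 : FreeGroup (Fin 2)) ∈ nielsenSubgroup := by
    have : MulAut.conj (of 1 : FreeGroup (Fin 2)) =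
        (nielsenMul * (nielsenInv * nielsenMul * nielsenInv))⁻¹ := by
      rw [eq_inv_iff_mul_eq_one]
      exact mulAut_ext (by simp [mul_assoc]) (by simp)
    rw [this]
    exact inv_mem (mul_mem nielsenMul_mem
      (mul_mem (mul_mem nielsenInv_mem nielsenMul_mem) nielsenInv_mem))
  have h0 : MulAut.conj (of 0 : FreeGroup (Fin 2)) ∈ nielsenSubgroup := by
    have : MulAut.conj (of 0 : FreeGroup (Fin 2)) =
        nielsenSwap * MulAut.conj (of 1) * nielsenSwap :=
      mulAut_ext (by simp) (by simp)
    rw [this]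
    exact mul_mem (mul_mem nielsenSwap_mem h1) nielsenSwap_mem
  induction g using FreeGroup.induction_on with
  | C1 => rw [_root_.map_one]; exact one_mem _
  | of i => fin_cases i <;> assumption
  | inv_of i h => rw [_root_.map_inv]; exact inv_mem h
  | mul x y hx hy => rw [_root_.map_mul]; exact mul_mem hx hy

theorem exists_mem_nielsenSubgroup_map_of (s t : Fin 2 × Bool) (h : s.1 ≠ t.1) :
    ∃ π ∈ nielsenSubgroup, π (of 0) = mk [s] ∧ π (of 1) = mk [t] := by
  have hs (e : Bool) : ∃ π ∈ nielsenSubgroup, π (of 0) = mk [(0, e)] ∧ π (of 1) = of 1 := by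
    cases e
    · exact ⟨_, nielsenInv_mem, by simp, by simp⟩
    · exact ⟨1, one_mem _, by simp, by simp⟩
  have hst (e d : Bool) :
      ∃ π ∈ nielsenSubgroup, π (of 0) = mk [(0, e)] ∧ π (of 1) = mk [(1, d)] := by
    obtain ⟨π, h1, h2, h3⟩ := hs e
    obtain ⟨π', h1', h2', h3'⟩ := hs d
    refine ⟨π * (nielsenSwap * π' * nielsenSwap),
      mul_mem h1 (mul_mem (mul_mem nielsenSwap_mem h1') nielsenSwap_mem), by simp [h2, h3'], ?_⟩
    cases d <;> simp_all
  obtain ⟨i, e⟩ := s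
  obtain ⟨j, d⟩ := t
  fin_cases i <;> fin_cases j
  · simp at h
  · exact hst e d
  · obtain ⟨π, h1, h2, h3⟩ := hst d e
    exact ⟨π * nielsenSwap, mul_mem h1 nielsenSwap_mem, by simpa using h3, by simpa using h2⟩
  · simp at h

theorem mk_singleton_not {α : Type*} (s : α × Bool) : mk [(s.1, !s.2)] = (mk [s])⁻¹ := by
  obtain ⟨i, _ | _⟩ := s <;> simp

theorem mk_singleton_ne_one {α : Type*} (s : α × Bool) : mk [s] ≠ 1 := by
  obtain ⟨i, _ | _⟩ := s <;> simp

theorem mem_nielsenSubgroup (φ : MulAut (FreeGroup (Fin 2))) : φ ∈ nielsenSubgroup := by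
  induction hN : norm (φ (of 0)) + norm (φ (of 1)) using Nat.strong_induction_on generalizing φ with
  | _ N ih =>
  subst hN
  by_contra hφ
  have hsum (s t : Fin 2 × Bool) (h : s.1 ≠ t.1) :
      norm (φ (mk [s])) + norm (φ (mk [t])) = norm (φ (of 0)) + norm (φ (of 1)) := by
    obtain ⟨i, e⟩ := s
    obtain ⟨j, d⟩ := t
    fin_cases i <;> fin_cases j <;> cases e <;> cases d <;> simp at h <;> simp [add_comm]
  -- Minimality of the counterexample: no Nielsen move on signed generators, even followed by a
  -- conjugation, shortens the total length.
  have hred (s t : Fin 2 × Bool) (h : s.1 ≠ t.1) (q : FreeGroup (Fin 2)) :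
      norm (φ (mk [s])) + norm (φ (mk [t])) ≤
        norm (q⁻¹ * (φ (mk [s]) * φ (mk [t])) * q) + norm (q⁻¹ * φ (mk [t]) * q) := by
    by_contra! hlt
    obtain ⟨π, hπ, p0, p1⟩ := exists_mem_nielsenSubgroup_map_of s t h
    apply hφ
    have := ih _ (by rwa [hsum s t h] at hlt) (MulAut.conj q⁻¹ * φ * (π * nielsenMul))
      (by simp [p0, p1, -mul_mk])
    rwa [Subgroup.mul_mem_cancel_right _ (mul_mem hπ nielsenMul_mem),
      Subgroup.mul_mem_cancel_left _ (conj_mem_nielsenSubgroup _)] at this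
  have hne (s : Fin 2 × Bool) : φ (mk [s]) ≠ 1 := by simpa using mk_singleton_ne_one s
  have hleft (s t : Fin 2 × Bool) (h : s.1 ≠ t.1) :
      2 * overlap (φ (mk [s]))⁻¹ (φ (mk [t])) ≤ norm (φ (mk [t])) := by
    have h1 := hred s t h 1
    have h2 := norm_mul_add (φ (mk [s])) (φ (mk [t]))
    simp only [inv_one, one_mul, mul_one] at h1
    omega
  have hright (s t : Fin 2 × Bool) (h : s.1 ≠ t.1) :
      2 * overlap (φ (mk [s]))⁻¹ (φ (mk [t])) ≤ norm (φ (mk [s])) := by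
    have := hleft (t.1, !t.2) (s.1, !s.2) h.symm
    rw [mk_singleton_not, mk_singleton_not, _root_.map_inv, _root_.map_inv, inv_inv, norm_inv_eq,
      overlap_comm] at this
    exact this
  have hpair (s t : Fin 2 × Bool) (h : s.1 = t.1 → s.2 = t.2) :
      2 * overlap (φ (mk [s]))⁻¹ (φ (mk [t])) ≤ norm (φ (mk [s])) ∧
      2 * overlap (φ (mk [s]))⁻¹ (φ (mk [t])) ≤ norm (φ (mk [t])) ∧
      (s.1 = t.1 → 2 * overlap (φ (mk [s]))⁻¹ (φ (mk [t])) < norm (φ (mk [t]))) := by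
    by_cases hi : s.1 = t.1
    · obtain rfl : s = t := Prod.ext hi (h hi)
      have := two_mul_overlap_inv_self_lt (hne s)
      omega
    · exact ⟨hright s t hi, hleft s t hi, fun h => absurd h hi⟩
  have htriple (s t r : Fin 2 × Bool) (h : s.1 = t.1 → s.2 = t.2) (h' : t.1 = r.1 → t.2 = r.2) :
      overlap (φ (mk [s]))⁻¹ (φ (mk [t])) + overlap (φ (mk [t]))⁻¹ (φ (mk [r])) <
        norm (φ (mk [t])) := by
    -- Each overlap is at most half of the middle word, so both are exactly half. In rank two the
    -- outer letters then have the same index.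
    by_contra! hle
    have h1 := hpair s t h
    have h2 := hpair t r h'
    have hst : s.1 ≠ t.1 := fun e => by have := h1.2.2 e; omega
    have htr : t.1 ≠ r.1 := fun e => by
      obtain rfl : t = r := Prod.ext e (h' e)
      have := h2.2.2 e
      omega
    have hsr : s.1 = r.1 := by omega
    by_cases hsr' : s.2 = r.2
    -- Equal outer letters: a conjugation would shorten the pair.
    · obtain rfl : s = r := Prod.ext hsr hsr'
      obtain ⟨q, hq⟩ := exists_conj_norm_lt (hne t) (a := φ (mk [s])) (by omega) (by omega)
        (by have := hsum s t hst; omega)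
      have := hred s t hst q
      omega
    -- Inverse outer letters: $\varphi(t)$ and its inverse both share half their length with
    -- $\varphi(s)^{-1}$, hence with each other, which is impossible.
    · obtain rfl : r = (s.1, !s.2) := Prod.ext hsr.symm (by
        rw [Bool.eq_not]
        exact Ne.symm hsr')
      rw [mk_singleton_not, _root_.map_inv] at hle h2
      have h3 := min_overlap_le (φ (mk [t]))⁻¹ (φ (mk [s]))⁻¹ (φ (mk [t]))
      have h4 := two_mul_overlap_inv_self_lt (hne t)
      omega
  have hnorm (g : FreeGroup (Fin 2)) : norm g ≤ norm (φ g) := by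
    have := length_le_norm_prod (f := fun s => φ (mk [s])) hne
      (fun s t h => by
        have := hpair s t h
        have h1 : norm (φ (mk [s])) ≠ 0 := by simpa using hne s
        have h2 : norm (φ (mk [t])) ≠ 0 := by simpa using hne t
        omega) htriple g.toWord isReduced_toWord
    have h2 := map_mk_eq_prod φ.toMonoidHom g.toWord
    rw [mk_toWord] at h2
    exact this.trans_eq (congrArg norm h2.symm)
  -- `hnorm` at $\varphi^{-1}(x_i)$ bounds its length by $1$.
  have hletter (i : Fin 2) : ∃ s, φ.symm (of i) = mk [s] :=
    exists_mk_singleton_of_norm_le_one (by simp) (by simpa using hnorm (φ.symm (of i)))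
  obtain ⟨s, hs⟩ := hletter 0
  obtain ⟨t, ht⟩ := hletter 1
  by_cases hst : s.1 = t.1
  · have key : φ.symm (of 0) = φ.symm (of 1) ∨ φ.symm (of 0) = φ.symm (of 1)⁻¹ := by
      rw [_root_.map_inv, hs, ht, ← mk_singleton_not]
      by_cases h : s.2 = t.2
      · exact .inl (by rw [Prod.ext hst h])
      · exact .inr (by rw [show s = (t.1, !t.2) from Prod.ext hst (Bool.eq_not.2 h)])
    rcases key with key | key
    · exact absurd (φ.symm.injective key) (by decide)
    · exact absurd (φ.symm.injective key) (by decide)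
  · obtain ⟨π, hπ, p0, p1⟩ := exists_mem_nielsenSubgroup_map_of s t hst
    have : φ⁻¹ = π := mulAut_ext (by rw [p0, ← hs]; rfl) (by rw [p1, ← ht]; rfl)
    exact hφ (inv_mem_iff.1 (this ▸ hπ))

/-- **Nielsen's theorem** in rank two. -/
theorem nielsenSubgroup_eq_top : nielsenSubgroup = ⊤ :=
  eq_top_iff.2 fun φ _ => mem_nielsenSubgroup φ

end FreeGroup

/-! ### The braid group, its action on the free group and its degree -/

namespace B3

/-- The universal property of `B₃`. -/
def lift {G : Type*} [Group G] (a b : G) (h : a * b * a = b * a * b) : B3 →* G :=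
  PresentedGroup.toGroup (f := ![a, b]) (by simp [braidRelator, h])

section
variable {G : Type*} [Group G] {a b : G} {h : a * b * a = b * a * b}

@[simp] theorem lift_s1 : lift a b h s1 = a := PresentedGroup.toGroup.of _
@[simp] theorem lift_s2 : lift a b h s2 = b := PresentedGroup.toGroup.of _

end

theorem braid_rel : s1 * s2 * s1 = s2 * s1 * s2 :=
  PresentedGroup.mk_eq_mk_of_mul_inv_mem (rels := {braidRelator})
    (x := FreeGroup.of 0 * FreeGroup.of 1 * FreeGroup.of 0)
    (y := FreeGroup.of 1 * FreeGroup.of 0 * FreeGroup.of 1) rfl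

theorem fullTwist_eq : a12 * a13 * a23 = (s1 * s2 * s1) * (s1 * s2 * s1) := by
  calc a12 * a13 * a23 = s1 * (s1 * s2 * s1) * s1 * s2 := by
        simp [a12, a13, a23, pow_two, mul_assoc]
    _ = s1 * (s2 * s1 * s2) * s1 * s2 := by rw [braid_rel]
    _ = (s1 * s2 * s1) * (s2 * s1 * s2) := by group
    _ = _ := by rw [braid_rel]

/-- The full twist is $\Delta^2$ with $\Delta=s_1s_2s_1$, and passing $\Delta$ exchanges $s_1$ and
$s_2$. -/
theorem commute_fullTwist_s1 : Commute (a12 * a13 * a23) s1 := by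
  have h1 : s1 * s2 * s1 * s1 = s2 * (s1 * s2 * s1) := by
    nth_rw 1 [braid_rel]; group
  have h2 : s1 * s2 * s1 * s2 = s1 * (s1 * s2 * s1) := by
    rw [mul_assoc, mul_assoc, ← mul_assoc s2, ← braid_rel]
  rw [fullTwist_eq, commute_iff_eq, mul_assoc, h1, ← mul_assoc, h2, mul_assoc]

theorem commute_fullTwist_s2 : Commute (a12 * a13 * a23) s2 := by
  have h1 : s1 * s2 * s1 * s1 = s2 * (s1 * s2 * s1) := by
    nth_rw 1 [braid_rel]; group
  have h2 : s1 * s2 * s1 * s2 = s1 * (s1 * s2 * s1) := by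
    rw [mul_assoc, mul_assoc, ← mul_assoc s2, ← braid_rel]
  rw [fullTwist_eq, commute_iff_eq, mul_assoc, h2, ← mul_assoc, h1, mul_assoc]

open FreeGroup in
/-- The action of `B₃` on the free group of rank two by which it acts by conjugation on
`P₃ / Z(P₃)`. -/
def action : B3 →* MulAut (FreeGroup (Fin 2)) :=
  lift
    (mkAut (of 1) ((of 1)⁻¹ * of 0 * of 1) (of 0 * of 1 * (of 0)⁻¹) (of 0)
      (by simp) (by simp [mul_assoc]) (by simp [mul_assoc]) (by simp))
    (mkAut ((of 0)⁻¹ * (of 1)⁻¹) (of 1) ((of 1)⁻¹ * (of 0)⁻¹) (of 1)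
      (by simp) (by simp) (by simp) (by simp))
    (mulAut_ext (by simp [mul_assoc]) (by simp [mul_assoc]))

theorem action_a13 : action a13 = MulAut.conj (FreeGroup.of 0) := by
  rw [a13, map_mul, map_inv, mul_inv_eq_iff_eq_mul]
  exact FreeGroup.mulAut_ext (by simp [action, pow_two, mul_assoc])
    (by simp [action, pow_two, mul_assoc])

theorem action_a23 : action a23 = MulAut.conj (FreeGroup.of 1) :=
  FreeGroup.mulAut_ext (by simp [action, a23, pow_two, mul_assoc])
    (by simp [action, a23, pow_two, mul_assoc])

theorem action_fullTwist : action (a12 * a13 * a23) = 1 := by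
  rw [map_mul, map_mul, action_a13, action_a23]
  exact FreeGroup.mulAut_ext (by simp [action, a12, pow_two, mul_assoc])
    (by simp [action, a12, pow_two, mul_assoc])

/-- The exponent sum of a braid. -/
def degree : B3 →* Multiplicative ℤ :=
  lift (Multiplicative.ofAdd 1) (Multiplicative.ofAdd 1) rfl

theorem degree_fullTwist : degree (a12 * a13 * a23) = Multiplicative.ofAdd 6 := by
  simp only [degree, a12, a13, a23, map_mul, map_pow, map_inv, lift_s1, lift_s2]
  rfl

end B3

/-! ### The decomposition of the pure braid group -/

namespace P3

theorem closure_eq_top : Subgroup.closure {A12, A13, A23} = ⊤ := by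
  refine eq_top_iff.2 ((Subgroup.closure_closure_coe_preimage
    (k := {B3.a12, B3.a13, B3.a23})).symm.trans_le ?_)
  refine Subgroup.closure_mono ?_
  rintro ⟨g, hg⟩ (h | h | h) <;> simp only [Set.mem_singleton_iff] at h <;> subst h
  · exact .inl rfl
  · exact .inr (.inl rfl)
  · exact .inr (.inr rfl)

theorem coe_z : (z : B3) = B3.a12 * B3.a13 * B3.a23 := rfl

theorem commute_z_right (g : P3) : Commute g z := by
  have hs (b : B3) : Commute (B3.a12 * B3.a13 * B3.a23) b := by
    have : b ∈ Subgroup.centralizer {B3.a12 * B3.a13 * B3.a23} := by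
      refine PresentedGroup.generated_by _ _ (fun i => ?_) b
      rw [Subgroup.mem_centralizer_singleton_iff]
      fin_cases i
      · exact B3.commute_fullTwist_s1.symm
      · exact B3.commute_fullTwist_s2.symm
    exact (Subgroup.mem_centralizer_singleton_iff.1 this).symm
  exact Subtype.ext (hs g).symm

/-- The inclusion of the free group on `A_{1,3}` and `A_{2,3}` in `P₃`. -/
def ofFree : FreeGroup (Fin 2) →* P3 := FreeGroup.lift ![A13, A23]

theorem action_ofFree (w : FreeGroup (Fin 2)) : B3.action (ofFree w) = MulAut.conj w := by
  have : (B3.action.comp P3.subtype).comp ofFree = MulAut.conj := by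
    ext i : 1
    fin_cases i
    · exact B3.action_a13
    · exact B3.action_a23
  exact DFunLike.congr_fun this w

/-- The homomorphism from the product of the free group on `A_{1,3}`, `A_{2,3}` and the infinite
cyclic group generated by `z` to `P₃`. -/
def prodHom : FreeGroup (Fin 2) × Multiplicative ℤ →* P3 :=
  ofFree.noncommCoprod (zpowersHom P3 z) fun _ n => (commute_z_right _).zpow_right n.toAdd

theorem prodHom_apply (w : FreeGroup (Fin 2)) (n : Multiplicative ℤ) :
    prodHom (w, n) = ofFree w * z ^ n.toAdd := rfl

theorem prodHom_injective : Function.Injective prodHom := by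
  refine (injective_iff_map_eq_one _).2 fun ⟨w, n⟩ h => ?_
  rw [prodHom_apply] at h
  -- The action kills `z`, leaving conjugation by `w`.
  have hw : w = 1 := by
    have := congrArg (fun g : P3 => B3.action g) h
    simp only [Subgroup.coe_mul, Subgroup.coe_zpow, map_mul B3.action, map_zpow B3.action,
      action_ofFree] at this
    rw [coe_z, B3.action_fullTwist, one_zpow, mul_one, Subgroup.coe_one, map_one] at this
    exact FreeGroup.conj_injective (this.trans (map_one MulAut.conj).symm)
  subst hw
  rw [map_one, one_mul] at h
  -- The exponent sum is now $6n$, so $n=0$.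
  have := congrArg (fun g : P3 => (B3.degree g).toAdd) h
  simp only [Subgroup.coe_zpow, map_zpow B3.degree] at this
  rw [coe_z, B3.degree_fullTwist] at this
  exact Prod.ext rfl (by simpa using this)

theorem prodHom_surjective : Function.Surjective prodHom := by
  rw [← MonoidHom.range_eq_top, eq_top_iff, ← closure_eq_top, Subgroup.closure_le]
  have h13 : A13 ∈ prodHom.range := ⟨(FreeGroup.of 0, 1), by simp [prodHom_apply, ofFree]⟩
  have h23 : A23 ∈ prodHom.range := ⟨(FreeGroup.of 1, 1), by simp [prodHom_apply, ofFree]⟩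
  have hz : A12 * A13 * A23 ∈ prodHom.range :=
    ⟨(1, Multiplicative.ofAdd 1), by simp [prodHom_apply, z]⟩
  rintro g (rfl | rfl | rfl)
  · rwa [mul_assoc, Subgroup.mul_mem_cancel_right _ (mul_mem h13 h23)] at hz
  · exact h13
  · exact h23

/-- The decomposition of `P₃` as the product of the free group on `A_{1,3}`, `A_{2,3}` and the
infinite cyclic group generated by `z`. -/
noncomputable def prodEquiv : FreeGroup (Fin 2) × Multiplicative ℤ ≃* P3 :=
  MulEquiv.ofBijective prodHom ⟨prodHom_injective, prodHom_surjective⟩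

theorem prodEquiv_apply (w : FreeGroup (Fin 2)) (n : Multiplicative ℤ) :
    prodEquiv (w, n) = ofFree w * z ^ n.toAdd := rfl

theorem A13_eq : A13 = prodEquiv (FreeGroup.of 0, 1) := by simp [prodEquiv_apply, ofFree]

theorem A23_eq : A23 = prodEquiv (FreeGroup.of 1, 1) := by simp [prodEquiv_apply, ofFree]

theorem z_eq : z = prodEquiv (1, Multiplicative.ofAdd 1) := by simp [prodEquiv_apply]

theorem A12_eq_mul : A12 = z * A23⁻¹ * A13⁻¹ := by simp [z]

theorem A12_eq :
    A12 = prodEquiv ((FreeGroup.of 1)⁻¹ * (FreeGroup.of 0)⁻¹, Multiplicative.ofAdd 1) := by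
  rw [A12_eq_mul, z_eq, A23_eq, A13_eq, ← map_inv, ← map_inv, ← map_mul, ← map_mul]
  simp

theorem mem_center_prodEquiv_iff (w : FreeGroup (Fin 2)) (n : Multiplicative ℤ) :
    prodEquiv (w, n) ∈ Subgroup.center P3 ↔ w = 1 := by
  constructor
  · intro h
    refine FreeGroup.conj_injective (MulEquiv.ext fun v => ?_)
    have := Subgroup.mem_center_iff.1 h (prodEquiv (v, 1))
    rw [← map_mul, ← map_mul, prodEquiv.injective.eq_iff] at this
    have := congrArg Prod.fst this
    simpa [mul_inv_eq_iff_eq_mul] using this.symm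
  · rintro rfl
    rw [prodEquiv_apply, map_one, one_mul]
    exact zpow_mem (Subgroup.mem_center_iff.2 fun g => commute_z_right g) _

theorem center_eq_zpowers : Subgroup.center P3 = Subgroup.zpowers z := by
  ext g
  obtain ⟨⟨w, n⟩, rfl⟩ := prodEquiv.surjective g
  rw [mem_center_prodEquiv_iff, Subgroup.mem_zpowers_iff]
  constructor
  · rintro rfl
    exact ⟨n.toAdd, by simp [prodEquiv_apply]⟩
  · rintro ⟨k, hk⟩
    rw [z_eq, ← map_zpow, prodEquiv.injective.eq_iff] at hk
    simpa using (congrArg Prod.fst hk).symm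

theorem mulAut_ext {f g : MulAut P3} (hz : f z = g z) (h13 : f A13 = g A13)
    (h23 : f A23 = g A23) : f = g := by
  have : f.toMonoidHom = g.toMonoidHom := by
    refine MonoidHom.eq_of_eqOn_dense closure_eq_top ?_
    rintro a (rfl | rfl | rfl)
    · change f _ = g _
      simp only [A12_eq_mul, map_mul, map_inv, hz, h13, h23]
    · exact h13
    · exact h23
  exact MulEquiv.ext fun a => DFunLike.congr_fun this a

/-- The isomorphism of the free group of rank two with `P₃ / Z(P₃)`. -/
noncomputable def quotientEquiv : FreeGroup (Fin 2) ≃* P3 ⧸ Subgroup.center P3 :=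
  MulEquiv.ofBijective ((QuotientGroup.mk' (Subgroup.center P3)).comp
    (prodEquiv.toMonoidHom.comp (MonoidHom.inl _ _))) <| by
  constructor
  · refine (injective_iff_map_eq_one _).2 fun w h => ?_
    exact (mem_center_prodEquiv_iff w 1).1 ((QuotientGroup.eq_one_iff _).1 h)
  · intro q
    obtain ⟨g, rfl⟩ := QuotientGroup.mk_surjective q
    obtain ⟨⟨w, n⟩, rfl⟩ := prodEquiv.surjective g
    refine ⟨w, QuotientGroup.eq.2 ?_⟩
    change (prodEquiv (w, 1))⁻¹ * _ ∈ _
    rw [← map_inv, ← map_mul]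
    exact (mem_center_prodEquiv_iff _ _).2 (by simp)

theorem quotientEquiv_apply (w : FreeGroup (Fin 2)) :
    quotientEquiv w = QuotientGroup.mk (prodEquiv (w, 1)) := rfl

/-! ### Automorphisms of the pure braid group -/

/-- The extension of an automorphism of the free factor of `P₃` by the identity on the center. -/
noncomputable def extendAut (α : MulAut (FreeGroup (Fin 2))) : MulAut P3 :=
  MulAut.congr prodEquiv (α.prodCongr (MulEquiv.refl _))

@[simp]
theorem extendAut_prodEquiv (α : MulAut (FreeGroup (Fin 2))) (p) :
    extendAut α (prodEquiv p) = prodEquiv (α p.1, p.2) := by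
  simp [extendAut, MulAut.congr]
  rfl

theorem autCentralQuotient_extendAut (α : MulAut (FreeGroup (Fin 2))) :
    autCentralQuotient P3 (extendAut α) = MulAut.congr quotientEquiv α := by
  ext q
  obtain ⟨w, rfl⟩ := quotientEquiv.surjective q
  have : MulAut.congr quotientEquiv α (quotientEquiv w) = quotientEquiv (α w) := by
    simp [MulAut.congr]
  rw [this, quotientEquiv_apply, quotientEquiv_apply]
  exact congrArg QuotientGroup.mk (extendAut_prodEquiv α _)

/-- The automorphism of `P₃` inverting the center and fixing the free factor. -/
noncomputable def invertCenter : MulAut P3 :=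
  MulAut.congr prodEquiv ((MulEquiv.refl _).prodCongr (MulEquiv.inv _))

@[simp]
theorem invertCenter_prodEquiv (p) : invertCenter (prodEquiv p) = prodEquiv (p.1, p.2⁻¹) := by
  simp [invertCenter, MulAut.congr]
  rfl

/-- The transvection of `P₃` multiplying each element of the free factor by a central element. -/
noncomputable def transvection (χ : FreeGroup (Fin 2) →* Multiplicative ℤ) : MulAut P3 :=
  MulAut.congr prodEquiv
    { toFun p := (p.1, p.2 * χ p.1)
      invFun p := (p.1, p.2 * (χ p.1)⁻¹)
      left_inv p := by simp
      right_inv p := by simp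
      map_mul' p q := by simp [mul_mul_mul_comm] }

@[simp]
theorem transvection_prodEquiv (χ : FreeGroup (Fin 2) →* Multiplicative ℤ) (p) :
    transvection χ (prodEquiv p) = prodEquiv (p.1, p.2 * χ p.1) := by
  simp [transvection, MulAut.congr]

theorem mem_centralAut_iff {f : MulAut P3} :
    f ∈ centralAut P3 ↔ ∀ g, ∃ n : ℤ, f g = g * z ^ n := by
  rw [centralAut, MonoidHom.mem_ker, DFunLike.ext_iff, QuotientGroup.mk_surjective.forall]
  refine forall_congr' fun g => ?_
  change QuotientGroup.mk (f g) = QuotientGroup.mk g ↔ _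
  rw [eq_comm, QuotientGroup.eq, center_eq_zpowers, Subgroup.mem_zpowers_iff]
  exact exists_congr fun n => by rw [eq_inv_mul_iff_mul_eq, eq_comm]

/-- An automorphism restricts to one of the center, which is infinite cyclic on `z`. -/
theorem apply_z_eq_or (f : MulAut P3) : f z = z ∨ f z = z⁻¹ := by
  have key (g : MulAut P3) : ∃ n : ℤ, g z = z ^ n := by
    have h : g z ∈ Subgroup.center P3 := by
      refine Subgroup.mem_center_iff.2 fun a => ?_
      obtain ⟨b, rfl⟩ := g.surjective a
      rw [← map_mul, ← map_mul, (commute_z_right b).eq]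
    rw [center_eq_zpowers, Subgroup.mem_zpowers_iff] at h
    exact h.imp fun n hn => hn.symm
  obtain ⟨m, hm⟩ := key f
  obtain ⟨n, hn⟩ := key f⁻¹
  have h : z ^ (n * m) = z ^ (1 : ℤ) := by
    rw [zpow_mul, ← hn, ← map_zpow, ← hm, zpow_one]
    exact f.symm_apply_apply z
  rw [z_eq, ← map_zpow, ← map_zpow, prodEquiv.injective.eq_iff] at h
  have h : n * m = 1 := by
    have := congrArg (fun p : FreeGroup (Fin 2) × Multiplicative ℤ => p.2.toAdd) h
    simpa using this
  rcases Int.isUnit_iff.1 (IsUnit.of_mul_eq_one_right _ h) with rfl | rfl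
  · exact .inl (by simpa using hm)
  · exact .inr (by simpa using hm)

theorem closure_eq_centralAut {ψ φ₁ φ₂ : MulAut P3}
    (ψz : ψ z = z⁻¹) (ψ13 : ψ A13 = A13) (ψ23 : ψ A23 = A23)
    (φ₁z : φ₁ z = z) (φ₁13 : φ₁ A13 = A13 * z⁻¹) (φ₁23 : φ₁ A23 = A23)
    (φ₂z : φ₂ z = z) (φ₂13 : φ₂ A13 = A13) (φ₂23 : φ₂ A23 = A23 * z⁻¹) :
    Subgroup.closure {ψ, φ₁, φ₂} = centralAut P3 := by
  have mem_of {f : MulAut P3} (hz : ∃ n : ℤ, f z = z * z ^ n) (h13 : ∃ n : ℤ, f A13 = A13 * z ^ n)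
      (h23 : ∃ n : ℤ, f A23 = A23 * z ^ n) : f ∈ centralAut P3 := by
    have hmul {a b : P3} (ha : ∃ n : ℤ, f a = a * z ^ n) (hb : ∃ n : ℤ, f b = b * z ^ n) :
        ∃ n : ℤ, f (a * b) = a * b * z ^ n := by
      obtain ⟨m, hm⟩ := ha
      obtain ⟨n, hn⟩ := hb
      refine ⟨m + n, ?_⟩
      rw [map_mul, hm, hn, zpow_add, mul_assoc, ← mul_assoc _ b,
        ← ((commute_z_right b).zpow_right m).eq]
      group
    have hinv {a : P3} (ha : ∃ n : ℤ, f a = a * z ^ n) : ∃ n : ℤ, f a⁻¹ = a⁻¹ * z ^ n := by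
      obtain ⟨m, hm⟩ := ha
      refine ⟨-m, ?_⟩
      rw [map_inv, hm, mul_inv_rev, zpow_neg,
        ((commute_z_right a⁻¹).zpow_right m).inv_right.eq]
    have h12 : ∃ n : ℤ, f A12 = A12 * z ^ n := by
      rw [A12_eq_mul]
      exact hmul (hmul hz (hinv h23)) (hinv h13)
    rw [mem_centralAut_iff]
    intro g
    have hg : g ∈ Subgroup.closure {A12, A13, A23} := closure_eq_top ▸ Subgroup.mem_top g
    induction hg using Subgroup.closure_induction with
    | mem x hx => rcases hx with rfl | rfl | rfl <;> assumption
    | one => exact ⟨0, by simp⟩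
    | mul x y _ _ hx hy => exact hmul hx hy
    | inv x _ hx => exact hinv hx
  apply le_antisymm
  · rw [Subgroup.closure_le]
    rintro f (rfl | rfl | rfl)
    -- The exponent is $-2$ because $z^{-1}=z\cdot z^{-2}$.
    · exact mem_of ⟨-2, by rw [ψz]; group⟩ ⟨0, by simpa⟩ ⟨0, by simpa⟩
    · exact mem_of ⟨0, by simpa⟩ ⟨-1, by simpa⟩ ⟨0, by simpa⟩
    · exact mem_of ⟨0, by simpa⟩ ⟨0, by simpa⟩ ⟨-1, by simpa⟩
  · have zpow_apply {φ : MulAut P3} {a c : P3} (hc : φ c = c) (ha : φ a = a * c) (n : ℤ) :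
        (φ ^ n) a = a * c ^ n := by
      have hc' (n : ℤ) : (φ ^ n) c = c := by
        have : φ ∈ MulAction.stabilizer (MulAut P3) c := hc
        exact zpow_mem this n
      have ha' : (φ⁻¹) a = a * c⁻¹ := by
        rw [MulAut.inv_apply, MulEquiv.symm_apply_eq, map_mul, map_inv, ha, hc,
          mul_inv_cancel_right]
      induction n with
      | zero => simp
      | succ n ih => rw [zpow_add_one, MulAut.mul_apply, ha, map_mul, ih, hc']; group
      | pred n ih => rw [zpow_sub_one, MulAut.mul_apply, ha', map_mul, ih, map_inv, hc']; group
    have zpow_fix {φ : MulAut P3} {a : P3} (ha : φ a = a) (n : ℤ) : (φ ^ n) a = a := by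
      have : φ ∈ MulAction.stabilizer (MulAut P3) a := ha
      exact zpow_mem this n
    intro f hf
    have hψ : ψ ∈ Subgroup.closure {ψ, φ₁, φ₂} := Subgroup.subset_closure (by simp)
    have hφ₁ : φ₁ ∈ Subgroup.closure {ψ, φ₁, φ₂} := Subgroup.subset_closure (by simp)
    have hφ₂ : φ₂ ∈ Subgroup.closure {ψ, φ₁, φ₂} := Subgroup.subset_closure (by simp)
    rw [mem_centralAut_iff] at hf
    obtain ⟨m, hm⟩ := hf A13
    obtain ⟨n, hn⟩ := hf A23
    have e₁ : (φ₁ ^ m) A13 = A13 * (z⁻¹) ^ m := zpow_apply (by rw [map_inv, φ₁z]) φ₁13 m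
    have e₂ : (φ₂ ^ n) A23 = A23 * (z⁻¹) ^ n := zpow_apply (by rw [map_inv, φ₂z]) φ₂23 n
    -- Composing on the left cancels the shifts $z^m,z^n$ even if `f` inverts `z`; only the sign on
    -- `z` survives, which leaves the identity or `ψ`.
    have g13 : (φ₁ ^ m * φ₂ ^ n * f) A13 = A13 := by
      simp [hm, zpow_fix φ₂13, zpow_fix φ₂z, zpow_fix φ₁z, e₁]
    have g23 : (φ₁ ^ m * φ₂ ^ n * f) A23 = A23 := by
      simp [hn, zpow_fix φ₁23, zpow_fix φ₂z, e₂]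
    have hg : φ₁ ^ m * φ₂ ^ n * f ∈ Subgroup.closure {ψ, φ₁, φ₂} := by
      rcases apply_z_eq_or (φ₁ ^ m * φ₂ ^ n * f) with h | h
      · rw [mulAut_ext (g := 1) h g13 g23]
        exact one_mem _
      · rw [mulAut_ext (g := ψ) (h.trans ψz.symm) (g13.trans ψ13.symm) (g23.trans ψ23.symm)]
        exact hψ
    rwa [Subgroup.mul_mem_cancel_left _ (mul_mem (zpow_mem hφ₁ m) (zpow_mem hφ₂ n))] at hg

/-- Nielsen's theorem transported along `quotientEquiv`. -/
theorem closure_autCentralQuotient_extendAut :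
    Subgroup.closure {autCentralQuotient P3 (extendAut FreeGroup.nielsenSwap),
      autCentralQuotient P3 (extendAut FreeGroup.nielsenInv),
      autCentralQuotient P3 (extendAut FreeGroup.nielsenMul)} = ⊤ := by
  have := FreeGroup.nielsenSubgroup_eq_top
  have := congrArg (Subgroup.map (MulAut.congr quotientEquiv).toMonoidHom) this
  rw [FreeGroup.nielsenSubgroup, MonoidHom.map_closure, Subgroup.map_top_of_surjective _
    (MulAut.congr quotientEquiv).surjective] at this
  rw [Set.image_insert_eq, Set.image_insert_eq, Set.image_singleton] at this
  simp only [autCentralQuotient_extendAut]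
  exact this

end P3

/-! ### Generators of the full automorphism group -/

theorem centralAut_sup_closure_eq_top {G : Type*} [Group G] {ρ σ ν : MulAut G}
    (h : Subgroup.closure {autCentralQuotient G ρ, autCentralQuotient G σ,
      autCentralQuotient G ν} = ⊤) :
    centralAut G ⊔ Subgroup.closure {ρ, σ, ν} = ⊤ := by
  have : Subgroup.map (autCentralQuotient G) (Subgroup.closure {ρ, σ, ν}) = ⊤ := by
    rw [MonoidHom.map_closure]
    simpa only [Set.image_insert_eq, Set.image_singleton] using h
  rw [eq_top_iff]
  intro f _
  obtain ⟨g, hg, hgf⟩ : autCentralQuotient G f ∈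
    Subgroup.map (autCentralQuotient G) (Subgroup.closure {ρ, σ, ν}) := this ▸ Subgroup.mem_top _
  have hk : f * g⁻¹ ∈ centralAut G := by
    rw [centralAut, MonoidHom.mem_ker, map_mul, map_inv, hgf, mul_inv_cancel]
  rw [← inv_mul_cancel_right f g]
  exact Subgroup.mul_mem_sup hk hg

theorem proposition4p5 :
    ∃ ρ σ ν ψ φ13 φ23 : MulAut P3,
      -- the six automorphisms, given by their values on the generators of `P₃`
      (ρ P3.A12 = P3.A23 * P3.A12 * P3.A23⁻¹ ∧ ρ P3.A13 = P3.A23 ∧ ρ P3.A23 = P3.A13) ∧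
      (σ P3.A12 = P3.A12 * P3.A13 ^ 2 ∧ σ P3.A13 = P3.A13⁻¹ ∧ σ P3.A23 = P3.A23) ∧
      (ν P3.A12 = P3.A23⁻¹ * P3.A12 ∧ ν P3.A13 = P3.A13 * P3.A23 ∧ ν P3.A23 = P3.A23) ∧
      (ψ P3.A12 = P3.A12 * P3.z ^ (-2 : ℤ) ∧ ψ P3.A13 = P3.A13 ∧ ψ P3.A23 = P3.A23) ∧
      (φ13 P3.A12 = P3.A12 * P3.z ∧ φ13 P3.A13 = P3.A13 * P3.z⁻¹ ∧ φ13 P3.A23 = P3.A23) ∧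
      (φ23 P3.A12 = P3.A12 * P3.z ∧ φ23 P3.A13 = P3.A13 ∧ φ23 P3.A23 = P3.A23 * P3.z⁻¹) ∧
      -- they generate `Aut(P₃)`
      Subgroup.closure {ρ, σ, ν, ψ, φ13, φ23} = (⊤ : Subgroup (MulAut P3)) ∧
      -- `ρ`, `σ`, `ν` fix the center pointwise
      (∀ c ∈ Subgroup.center P3, ρ c = c ∧ σ c = c ∧ ν c = c) ∧
      -- `P₃ / Z(P₃)` is free on the classes of `A_{1,3}` and `A_{2,3}`
      (∃ e : FreeGroup (Fin 2) ≃* (P3 ⧸ Subgroup.center P3),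
        e (FreeGroup.of 0) = QuotientGroup.mk P3.A13 ∧
        e (FreeGroup.of 1) = QuotientGroup.mk P3.A23) ∧
      -- `ρ`, `σ`, `ν` induce generators of `Aut(P₃ / Z(P₃))`
      Subgroup.closure {autCentralQuotient P3 ρ, autCentralQuotient P3 σ,
        autCentralQuotient P3 ν} = (⊤ : Subgroup (MulAut (P3 ⧸ Subgroup.center P3))) ∧
      -- `ψ`, `φ13`, `φ23` generate the central automorphisms
      Subgroup.closure {ψ, φ13, φ23} = centralAut P3 ∧
      -- hence the central automorphisms together with `ρ`, `σ`, `ν` generate `Aut(P₃)`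
      centralAut P3 ⊔ Subgroup.closure {ρ, σ, ν} = (⊤ : Subgroup (MulAut P3)) := by
  have hρz : P3.extendAut FreeGroup.nielsenSwap P3.z = P3.z := by simp [P3.z_eq]
  have hσz : P3.extendAut FreeGroup.nielsenInv P3.z = P3.z := by simp [P3.z_eq]
  have hνz : P3.extendAut FreeGroup.nielsenMul P3.z = P3.z := by simp [P3.z_eq]
  have hcentral := P3.closure_eq_centralAut (ψ := P3.invertCenter)
    (φ₁ := P3.transvection (FreeGroup.lift ![Multiplicative.ofAdd (-1), 1]))
    (φ₂ := P3.transvection (FreeGroup.lift ![1, Multiplicative.ofAdd (-1)]))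
    (by simp [P3.z_eq, ← map_inv]) (by simp [P3.A13_eq]) (by simp [P3.A23_eq])
    (by simp [P3.z_eq]) (by simp [P3.A13_eq, P3.z_eq, ← map_inv, ← map_mul])
    (by simp [P3.A23_eq])
    (by simp [P3.z_eq]) (by simp [P3.A13_eq])
    (by simp [P3.A23_eq, P3.z_eq, ← map_inv, ← map_mul])
  have hsup := centralAut_sup_closure_eq_top P3.closure_autCentralQuotient_extendAut
  refine ⟨P3.extendAut FreeGroup.nielsenSwap, P3.extendAut FreeGroup.nielsenInv,
    P3.extendAut FreeGroup.nielsenMul, P3.invertCenter,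
    P3.transvection (FreeGroup.lift ![Multiplicative.ofAdd (-1), 1]),
    P3.transvection (FreeGroup.lift ![1, Multiplicative.ofAdd (-1)]), ?_, ?_, ?_, ?_, ?_, ?_, ?_,
    ?_, ⟨P3.quotientEquiv, ?_, ?_⟩, P3.closure_autCentralQuotient_extendAut, hcentral, hsup⟩
  -- The prescribed values become identities between coordinates in $F\times\mathbb Z$, where
  -- $A_{1,2}$ is $((A_{1,3}A_{2,3})^{-1},1)$.
  iterate 6
    simp only [P3.A12_eq, P3.A13_eq, P3.A23_eq, P3.z_eq, ← map_inv, ← map_mul, ← map_pow,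
      ← map_zpow, P3.extendAut_prodEquiv, P3.invertCenter_prodEquiv, P3.transvection_prodEquiv,
      P3.prodEquiv.injective.eq_iff]
    simp [mul_assoc, pow_two]
  · rw [eq_top_iff, ← hsup, ← hcentral, ← Subgroup.closure_union]
    refine Subgroup.closure_mono ?_
    rintro f ((rfl | rfl | rfl) | (rfl | rfl | rfl)) <;> simp
  · intro c hc
    rw [P3.center_eq_zpowers, Subgroup.mem_zpowers_iff] at hc
    obtain ⟨n, rfl⟩ := hc
    simp [hρz, hσz, hνz]
  · rw [P3.quotientEquiv_apply, P3.A13_eq]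
  · rw [P3.quotientEquiv_apply, P3.A23_eq]
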